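/- Let $n\ge 2$, let $N$ be a compact smooth $(n-1)$-dimensional manifold, with or without boundary, and let $M=\mathbb R\times N$ with coordinate $r$ on the first factor. Let $\hat G$ be a smooth Riemannian metric on $N$ with Riemannian volume measure $\mu_{\hat G}$, and let $g_0=dr^2+\hat G$. Let $g=dr^2+G(r)$ be a smooth Riemannian metric on $M$, where $(G(r))_{r\in\mathbb R}$ is a family of Riemannian metrics on $N$. Let $H$ and $\mathring H$ be the mean curvatures of the level sets $\{r\}\times N$ with respect to $g$ and $g_0$, that is, the traces of their Weingarten maps $X\mapsto\nabla_X\partial_r$. Put $$m(r,x)=\mathring H(r,x)-H(r,x),\qquad \mathcal M(r)=\int_N m(r,x)\,d\mu_{\hat G}(x),$$ and let $R_{rr}=\mathrm{Ric}_g(\partial_r,\partial_r)$. Assume that the (finite) limits $\mathcal M(\pm\infty)=\lim_{r\to\pm\infty}\mathcal M(r)$ exist and that $R_{rr}\in L^1(M,dr\,d\mu_{\hat G})$. Then $$\mathcal M(+\infty)-\mathcal M(-\infty)\ \ge\ \int_M R_{rr}\,dr\,d\mu_{\hat G},$$ with equality if and only if $g$ is a product, i.e. $g=dr^2+\widetilde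 G$ for some Riemannian metric $\widetilde G$ on $N$ that does not depend on $r$. Moreover, let $r_0\in[-\infty,+\infty]$ and suppose that $g$ is asymptotic to $g_0$ at $r_0$, i.e. that $\sup_{x\in N}\|G(r)-\hat G\|_{\hat G}(x)\to0$ as $r\to r_0$, where $\|\cdot\|_{\hat G}$ is the norm of $2$-tensors induced by $\hat G$ (for finite $r_0$ this means $G(r_0)=\hat G$). Then equality holds if and only if $g=g_0$. -/

import Mathlib

open MeasureTheory Filter
open scoped Manifold ContDiff Topology

noncomputable section

/-- Smooth Riemannian metrics on a manifold `X` (possibly with boundary). -/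
abbrev SmoothMetric {E H : Type*} [NormedAddCommGroup E] [NormedSpace ℝ E] [TopologicalSpace H]
    (I : ModelWithCorners ℝ E H) (X : Type*) [TopologicalSpace X] [ChartedSpace H X]
    [IsManifold I ∞ X] :=
  Bundle.ContMDiffRiemannianMetric I ∞ E (fun x : X ↦ TangentSpace I x)

section LocalCoordinates

variable {E H ι : Type*} [NormedAddCommGroup E] [NormedSpace ℝ E] [TopologicalSpace H]
  {I : ModelWithCorners ℝ E H} {X : Type*} [TopologicalSpace X] [ChartedSpace H X]
  [IsManifold I ∞ X] [Fintype ι] [DecidableEq ι]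

/-- The components `g_ij(y) = g(∂_i, ∂_j)` of the metric in the chart centred at `p`, where
`∂_i` is the image of the basis vector `b i` under the differential of the inverse chart. -/
def metricMatrix (b : Module.Basis ι ℝ E) (g : SmoothMetric I X) (p : X) (y : E) :
    Matrix ι ι ℝ :=
  Matrix.of fun i j ↦ g.inner ((extChartAt I p).symm y)
    (mfderivWithin 𝓘(ℝ, E) I (extChartAt I p).symm (Set.range I) y (b i))
    (mfderivWithin 𝓘(ℝ, E) I (extChartAt I p).symm (Set.range I) y (b j))

/-- The partial derivative `∂_i f` of a function of the coordinates (one-sided at the boundary). -/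
def coordDeriv (I : ModelWithCorners ℝ E H) (b : Module.Basis ι ℝ E) (i : ι) (f : E → ℝ)
    (y : E) : ℝ :=
  fderivWithin ℝ f (Set.range I) y (b i)

/-- The Christoffel symbols `Γ^k_ij = ½ g^{kl} (∂_i g_jl + ∂_j g_il - ∂_l g_ij)` of the
Levi-Civita connection, in the chart centred at `p`. -/
def christoffel (b : Module.Basis ι ℝ E) (g : SmoothMetric I X) (p : X) (k i j : ι) (y : E) : ℝ :=
  (1 / 2 : ℝ) * ∑ l, (metricMatrix b g p y)⁻¹ k l *
    (coordDeriv I b i (fun z ↦ metricMatrix b g p z j l) y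
      + coordDeriv I b j (fun z ↦ metricMatrix b g p z i l) y
      - coordDeriv I b l (fun z ↦ metricMatrix b g p z i j) y)

/-- The components of the Ricci tensor in the chart centred at `p`:
`R_ij = ∂_k Γ^k_ij - ∂_j Γ^k_ik + Γ^k_kl Γ^l_ij - Γ^k_jl Γ^l_ik`
(nonnegative on round spheres). -/
def ricciComponent (b : Module.Basis ι ℝ E) (g : SmoothMetric I X) (p : X) (i j : ι) (y : E) : ℝ :=
  ∑ k, (coordDeriv I b k (christoffel b g p k i j) y
      - coordDeriv I b j (christoffel b g p k i k) y)
    + ∑ k, ∑ l, (christoffel b g p k k l y * christoffel b g p l i j y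
      - christoffel b g p k j l y * christoffel b g p l i k y)

/-- The Ricci curvature `Ric_p(u, v)` of `g`. It is computed in the chart centred at `p`, for which
the tangent space at `p` is identified with the model space `E`. -/
def ricci (b : Module.Basis ι ℝ E) (g : SmoothMetric I X) (p : X) (u v : TangentSpace I p) : ℝ :=
  ∑ i, ∑ j, b.repr (u : E) i * b.repr (v : E) j * ricciComponent b g p i j (extChartAt I p p)

end LocalCoordinates

section Volume

variable {d : ℕ} {H : Type*} [TopologicalSpace H]
  {I : ModelWithCorners ℝ (EuclideanSpace ℝ (Fin d)) H} {N : Type*} [TopologicalSpace N]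
  [ChartedSpace H N] [IsManifold I ∞ N]

/-- The standard basis of `ℝ^d`. -/
def stdBasis (d : ℕ) : Module.Basis (Fin d) ℝ (EuclideanSpace ℝ (Fin d)) :=
  (EuclideanSpace.basisFun (Fin d) ℝ).toBasis

/-- A smooth partition of unity of `N` subordinate to the domains of the charts. -/
def chartPartition (I : ModelWithCorners ℝ (EuclideanSpace ℝ (Fin d)) H) (N : Type*)
    [TopologicalSpace N] [ChartedSpace H N] [IsManifold I ∞ N] [T2Space N] [SigmaCompactSpace N] :
    SmoothPartitionOfUnity N I N Set.univ :=
  Classical.choose (SmoothPartitionOfUnity.exists_isSubordinate_chartAt_source I N)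

/-- The Riemannian volume measure `μ_K` of the metric `K`, by the usual formula
`∫ f dμ_K = ∑_c ∫ (ρ_c f)(φ_c⁻¹ y) √(det K_ij(y)) dy`, with `φ_c` the charts of `N` and `ρ_c` a
partition of unity subordinate to them (the result does not depend on the partition). -/
def riemannianVolume [T2Space N] [SigmaCompactSpace N] [MeasurableSpace N]
    (K : SmoothMetric I N) : Measure N :=
  Measure.sum fun c : N ↦
    Measure.map (extChartAt I c).symm
      ((volume.restrict (extChartAt I c).target).withDensity fun y ↦
        ENNReal.ofReal (chartPartition I N c ((extChartAt I c).symm y) *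
          Real.sqrt (metricMatrix (stdBasis d) K c y).det))

end Volume

section Cylinder

variable {d : ℕ} {H : Type*} [TopologicalSpace H]
  {I : ModelWithCorners ℝ (EuclideanSpace ℝ (Fin d)) H} {N : Type*} [TopologicalSpace N]
  [ChartedSpace H N] [IsManifold I ∞ N]

/-- Smooth Riemannian metrics on the cylinder `ℝ × N`. -/
abbrev CylinderMetric (I : ModelWithCorners ℝ (EuclideanSpace ℝ (Fin d)) H) (N : Type*)
    [TopologicalSpace N] [ChartedSpace H N] [IsManifold I ∞ N] :=
  SmoothMetric (𝓘(ℝ, ℝ).prod I) (ℝ × N)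

/-- `g = dr² + G(r)`. -/
def IsRadialForm (g : CylinderMetric I N) (G : ℝ → SmoothMetric I N) : Prop :=
  ∀ (r : ℝ) (x : N) (u v : ℝ × EuclideanSpace ℝ (Fin d)),
    g.inner (r, x) u v = u.1 * v.1 + (G r).inner x u.2 v.2

/-- `g = dr² + h(r)² K`, with `K` a fixed metric on `N`. For `h = 1` this says that `g` is the
product of the line and `(N, K)`. -/
def IsWarpedProduct (g : CylinderMetric I N) (h : ℝ → ℝ) (K : SmoothMetric I N) : Prop :=
  ∀ (r : ℝ) (x : N) (u v : ℝ × EuclideanSpace ℝ (Fin d)),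
    g.inner (r, x) u v = u.1 * v.1 + h r ^ 2 * K.inner x u.2 v.2

/-- The basis of `ℝ × ℝ^d` corresponding to coordinates `(r, x^1, …, x^d)`: the index `inl ()` is
the radial direction, `inr A` is the direction `x^A`. -/
def cylinderBasis (d : ℕ) :
    Module.Basis (Unit ⊕ Fin d) ℝ (ℝ × EuclideanSpace ℝ (Fin d)) :=
  (Module.Basis.singleton Unit ℝ).prod (stdBasis d)

/-- The vector `∂_r` at the point `p` of `ℝ × N`. -/
def radialVector (I : ModelWithCorners ℝ (EuclideanSpace ℝ (Fin d)) H) (p : ℝ × N) :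
    TangentSpace (𝓘(ℝ, ℝ).prod I) p :=
  ((1, 0) : ℝ × EuclideanSpace ℝ (Fin d))

/-- `R_rr = Ric(∂_r, ∂_r)`. -/
def radialRicci (g : CylinderMetric I N) (p : ℝ × N) : ℝ :=
  ricci (cylinderBasis d) g p (radialVector I p) (radialVector I p)

/-- The Weingarten map `∂_A ↦ ∇_{∂_A} ∂_r = S_A^B ∂_B` of the level set of `r` through `p`, for a
metric of the form `dr² + G(r)` (so that `∂_r` is the unit normal); the entry in row `B` and
column `A` is `S_A^B = Γ^B_{Ar}`. -/
def weingarten (g : CylinderMetric I N) (p : ℝ × N) : Matrix (Fin d) (Fin d) ℝ :=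
  Matrix.of fun B A ↦ christoffel (cylinderBasis d) g p (Sum.inr B) (Sum.inr A) (Sum.inl ())
    (extChartAt (𝓘(ℝ, ℝ).prod I) p p)

/-- The mean curvature of the level set of `r` through `p`: the trace of the Weingarten map. -/
def meanCurvature (g : CylinderMetric I N) (p : ℝ × N) : ℝ :=
  (weingarten g p).trace

/-- The radial mass `m(r, x) = h(r)² (H₀ - H)` of `g` relative to `g₀ = dr² + h(r)² K`. -/
def radialMass (h : ℝ → ℝ) (g₀ g : CylinderMetric I N) (p : ℝ × N) : ℝ :=
  h p.1 ^ 2 * (meanCurvature g₀ p - meanCurvature g p)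

/-- The radial mass `𝓜(r) = ∫_N m(r, x) dμ_K(x)` of `g` relative to `g₀ = dr² + h(r)² K`. -/
def totalRadialMass [T2Space N] [SigmaCompactSpace N] [MeasurableSpace N] (h : ℝ → ℝ)
    (K : SmoothMetric I N) (g₀ g : CylinderMetric I N) (r : ℝ) : ℝ :=
  ∫ x, radialMass h g₀ g (r, x) ∂(riemannianVolume K)

/-- The matrix of the inner product `K_x` in the standard basis of `T_x N = ℝ^d`. -/
def fiberMatrix (K : SmoothMetric I N) (x : N) : Matrix (Fin d) (Fin d) ℝ :=
  Matrix.of fun i j ↦ K.inner x (stdBasis d i) (stdBasis d j)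

/-- The norm `√(γ^{AC} γ^{BD} T_AB T_CD)` of a 2-tensor `T` with respect to the inner
product `γ`. -/
def tensorNorm (γ T : Matrix (Fin d) (Fin d) ℝ) : ℝ :=
  Real.sqrt (γ⁻¹ * T * γ⁻¹ * T.transpose).trace

/-- The metric `dr² + G(r)` is asymptotic at `r₀ ∈ [-∞, ∞]` to `dr² + h(r)² K`:
`‖G(r) - h(r)² K‖` is `o(1)` as `r → r₀`, uniformly on `N`, the norm being that of `h(r)² K`. -/
def IsAsymptoticAt (G : ℝ → SmoothMetric I N) (h : ℝ → ℝ) (K : SmoothMetric I N)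
    (r₀ : EReal) : Prop :=
  ∀ ε : ℝ, 0 < ε → ∀ᶠ r in comap (fun t : ℝ ↦ (t : EReal)) (𝓝 r₀), ∀ x : N,
    tensorNorm (h r ^ 2 • fiberMatrix K x) (fiberMatrix (G r) x - h r ^ 2 • fiberMatrix K x) < ε

end Cylinder

end

noncomputable section

theorem ContinuousLinearMap.apply_sum_smul_sum_smul {V ι κ : Type*} [AddCommGroup V] [Module ℝ V]
    [TopologicalSpace V] [Fintype ι] [Fintype κ] (B : V →L[ℝ] V →L[ℝ] ℝ) (s : ι → ℝ) (t : κ → ℝ)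
    (v : ι → V) (w : κ → V) :
    B (∑ i, s i • v i) (∑ j, t j • w j) = ∑ i, ∑ j, s i * t j * B (v i) (w j) := by
  simp only [map_sum, map_smul, _root_.sum_apply, _root_.smul_apply, smul_eq_mul, Finset.mul_sum]
  rw [Finset.sum_comm]
  exact Finset.sum_congr rfl fun i _ ↦ Finset.sum_congr rfl fun j _ ↦ by ring

section MetricMatrix

open Matrix

variable {E H ι : Type*} [NormedAddCommGroup E] [NormedSpace ℝ E] [TopologicalSpace H]
  {I : ModelWithCorners ℝ E H} {X : Type*} [TopologicalSpace X] [ChartedSpace H X]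
  [IsManifold I ∞ X]

/-- The vector `∂_v` of the chart centred at `p`, at the point with coordinates `y`. -/
def chartVector (I : ModelWithCorners ℝ E H) {X : Type*} [TopologicalSpace X] [ChartedSpace H X]
    [IsManifold I ∞ X] (p : X) (v y : E) : TangentSpace I ((extChartAt I p).symm y) :=
  mfderivWithin 𝓘(ℝ, E) I (extChartAt I p).symm (Set.range I) y v

theorem contMDiffOn_chartVector (p : X) (v : E) :
    ContMDiffOn 𝓘(ℝ, E) I.tangent ∞
      (fun y ↦ (Bundle.TotalSpace.mk' E ((extChartAt I p).symm y) (chartVector I p v y) :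
        TangentBundle I X)) (extChartAt I p).target := by
  have h := (contMDiffOn_extChartAt_symm (I := I) (n := ∞) p).contMDiffOn_tangentMapWithin
    (m := ∞) le_rfl (uniqueDiffOn_extChartAt_target p).uniqueMDiffOn
  have hv : ContMDiff 𝓘(ℝ, E) 𝓘(ℝ, E).tangent ∞
      (fun y ↦ (Bundle.TotalSpace.mk' E y v : TangentBundle 𝓘(ℝ, E) E)) := by
    exact contMDiff_vectorSpace_iff_contDiff.2 contDiff_const
  refine (h.comp hv.contMDiffOn (fun y hy ↦ hy)).congr fun y hy ↦ ?_
  simp only [Function.comp_apply, tangentMapWithin, chartVector, Bundle.TotalSpace.mk']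
  congr 2
  exact (mfderivWithin_subset (extChartAt_target_subset_range p)
    (uniqueDiffOn_extChartAt_target p y hy).uniqueMDiffWithinAt
    (mdifferentiableWithinAt_extChartAt_symm hy)).symm

theorem contDiffOn_metricMatrix (b : Module.Basis ι ℝ E) (g : SmoothMetric I X) (p : X) (i j : ι) :
    ContDiffOn ℝ ∞ (fun y ↦ metricMatrix b g p y i j) (extChartAt I p).target := by
  rw [← contMDiffOn_iff_contDiffOn]
  have h1 : ContMDiffOn 𝓘(ℝ, E) (I.prod 𝓘(ℝ, E →L[ℝ] E →L[ℝ] ℝ)) ∞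
      (fun y ↦ @Bundle.TotalSpace.mk' X
        (fun x : X ↦ TangentSpace I x →L[ℝ] TangentSpace I x →L[ℝ] ℝ) (E →L[ℝ] E →L[ℝ] ℝ)
        ((extChartAt I p).symm y) (g.inner ((extChartAt I p).symm y))) (extChartAt I p).target :=
    g.contMDiff.comp_contMDiffOn (contMDiffOn_extChartAt_symm p)
  have h2 : ContMDiffOn 𝓘(ℝ, E) (I.prod 𝓘(ℝ, ℝ)) ∞
      (fun y ↦ Bundle.TotalSpace.mk' ℝ (E := Bundle.Trivial X ℝ)
        ((extChartAt I p).symm y) (g.inner ((extChartAt I p).symm y) (chartVector I p (b i) y)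
          (chartVector I p (b j) y))) (extChartAt I p).target :=
    ContMDiffOn.clm_bundle_apply₂ (F₁ := E) (F₂ := E) h1 (contMDiffOn_chartVector p (b i))
      (contMDiffOn_chartVector p (b j))
  intro y hy
  exact ((Bundle.contMDiffWithinAt_totalSpace).1 (h2 y hy)).2

theorem metricMatrix_isSymm (b : Module.Basis ι ℝ E) (g : SmoothMetric I X) (p : X) (y : E) :
    (metricMatrix b g p y).IsSymm := by
  ext i j
  exact g.symm _ _ _

theorem metricMatrix_posDef [Fintype ι] (b : Module.Basis ι ℝ E) (g : SmoothMetric I X) (p : X)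
    {y : E} (hy : y ∈ (extChartAt I p).target) : (metricMatrix b g p y).PosDef := by
  refine Matrix.PosDef.of_dotProduct_mulVec_pos ?_ fun v hv ↦ ?_
  · rw [Matrix.IsHermitian, Matrix.conjTranspose_eq_transpose_of_trivial]
    exact metricMatrix_isSymm b g p y
  · have hw : chartVector I p (∑ i, v i • b i) y ≠ 0 := by
      intro h
      have h0 := (isInvertible_mfderivWithin_extChartAt_symm (I := I) hy).injective
        (h.trans (map_zero _).symm)
      exact hv (funext fun i ↦ Fintype.linearIndependent_iff.1 b.linearIndependent v h0 i)
    have hsum : chartVector I p (∑ i, v i • b i) y = ∑ i, v i • chartVector I p (b i) y := by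
      let A : E →L[ℝ] TangentSpace I ((extChartAt I p).symm y) :=
        mfderivWithin 𝓘(ℝ, E) I (extChartAt I p).symm (Set.range I) y
      exact (map_sum A _ _).trans (Finset.sum_congr rfl fun i _ ↦ map_smul A _ _)
    have h := g.pos _ _ hw
    rw [hsum, ContinuousLinearMap.apply_sum_smul_sum_smul] at h
    convert! h using 1
    simp only [dotProduct, mulVec, Pi.star_apply, star_trivial, Finset.mul_sum]
    refine Finset.sum_congr rfl fun i _ ↦ Finset.sum_congr rfl fun j _ ↦ ?_
    change v i * (g.inner _ (chartVector I p (b i) y) (chartVector I p (b j) y) * v j) = _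
    ring

end MetricMatrix

section FiberMatrix

open Matrix

variable {d : ℕ} {H : Type*} [TopologicalSpace H]
  {I : ModelWithCorners ℝ (EuclideanSpace ℝ (Fin d)) H} {N : Type*} [TopologicalSpace N]
  [ChartedSpace H N] [IsManifold I ∞ N]

/-- The matrix of the differential of the inverse chart centred at `p`, at the point with
coordinates `y`. -/
def chartMatrix (I : ModelWithCorners ℝ (EuclideanSpace ℝ (Fin d)) H) {N : Type*}
    [TopologicalSpace N] [ChartedSpace H N] [IsManifold I ∞ N] (p : N)
    (y : EuclideanSpace ℝ (Fin d)) : Matrix (Fin d) (Fin d) ℝ :=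
  Matrix.of fun k i ↦ (stdBasis d).repr (chartVector I p (stdBasis d i) y) k

theorem metricMatrix_eq_fiberMatrix (K : SmoothMetric I N) (p : N)
    (y : EuclideanSpace ℝ (Fin d)) :
    metricMatrix (stdBasis d) K p y =
      (chartMatrix I p y)ᵀ * fiberMatrix K ((extChartAt I p).symm y) * chartMatrix I p y := by
  ext i j
  have h (i : Fin d) : chartVector I p (stdBasis d i) y =
      ∑ k, chartMatrix I p y k i • (show TangentSpace I ((extChartAt I p).symm y) from
        stdBasis d k) :=
    ((stdBasis d).sum_repr _).symm
  change K.inner _ (chartVector I p (stdBasis d i) y) (chartVector I p (stdBasis d j) y) = _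
  rw [h i, h j, ContinuousLinearMap.apply_sum_smul_sum_smul, Finset.sum_comm]
  simp only [Matrix.mul_apply, Matrix.transpose_apply, Finset.sum_mul, fiberMatrix, of_apply]
  exact Finset.sum_congr rfl fun k _ ↦ Finset.sum_congr rfl fun l _ ↦ by ring

theorem isUnit_det_chartMatrix (p : N) {y : EuclideanSpace ℝ (Fin d)}
    (hy : y ∈ (extChartAt I p).target) : IsUnit (chartMatrix I p y).det := by
  have h := isInvertible_mfderivWithin_extChartAt_symm (I := I) hy
  obtain ⟨e, he⟩ := h
  have : chartMatrix I p y = LinearMap.toMatrix (stdBasis d) (stdBasis d)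
      (show EuclideanSpace ℝ (Fin d) ≃ₗ[ℝ] EuclideanSpace ℝ (Fin d) from
        e.toLinearEquiv).toLinearMap := by
    ext k i
    rw [LinearMap.toMatrix_apply, chartMatrix, of_apply, chartVector, ← he]
    rfl
  rw [this]
  exact LinearEquiv.isUnit_det _ _ _

end FiberMatrix

section MatrixFamilies

open Matrix

variable {n : Type*} [Fintype n] [DecidableEq n]

/-- The entrywise derivative of a curve of matrices. -/
def matrixDeriv (M : ℝ → Matrix n n ℝ) (r : ℝ) : Matrix n n ℝ :=
  Matrix.of fun i j ↦ deriv (fun s ↦ M s i j) r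

/-- Half the logarithmic derivative `½ M⁻¹ M'` of a curve of matrices. -/
def shapeMatrix (M : ℝ → Matrix n n ℝ) (r : ℝ) : Matrix n n ℝ :=
  (1 / 2 : ℝ) • ((M r)⁻¹ * matrixDeriv M r)

omit [DecidableEq n] in
theorem matrixDeriv_mul_mul {M : ℝ → Matrix n n ℝ} {r : ℝ}
    (hM : ∀ i j, DifferentiableAt ℝ (fun s ↦ M s i j) r) (A B : Matrix n n ℝ) :
    matrixDeriv (fun s ↦ A * M s * B) r = A * matrixDeriv M r * B := by
  ext i j
  simp only [matrixDeriv, of_apply, Matrix.mul_apply, Finset.sum_mul]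
  refine HasDerivAt.deriv ?_
  refine HasDerivAt.fun_sum fun k _ ↦ HasDerivAt.fun_sum fun l _ ↦ ?_
  exact ((hM l k).hasDerivAt.const_mul _).mul_const _

omit [DecidableEq n] in
theorem differentiableAt_mul_mul {M : ℝ → Matrix n n ℝ} {r : ℝ}
    (hM : ∀ i j, DifferentiableAt ℝ (fun s ↦ M s i j) r) (A B : Matrix n n ℝ) (i j : n) :
    DifferentiableAt ℝ (fun s ↦ (A * M s * B) i j) r := by
  simp only [Matrix.mul_apply, Finset.sum_mul]
  exact DifferentiableAt.fun_sum fun k _ ↦ DifferentiableAt.fun_sum fun l _ ↦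
    ((hM l k).const_mul _).mul_const _

theorem shapeMatrix_congruence {M : ℝ → Matrix n n ℝ} {r : ℝ}
    (hM : ∀ i j, DifferentiableAt ℝ (fun s ↦ M s i j) r) {P : Matrix n n ℝ} (hP : IsUnit P.det) :
    shapeMatrix (fun s ↦ Pᵀ * M s * P) r = P⁻¹ * shapeMatrix M r * P := by
  have hP' : IsUnit (Pᵀ).det := by rwa [det_transpose]
  simp only [shapeMatrix, matrixDeriv_mul_mul hM, Matrix.mul_inv_rev, Matrix.mul_smul, Matrix.smul_mul]
  congr 1
  simp only [Matrix.mul_assoc]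
  rw [← Matrix.mul_assoc (Pᵀ)⁻¹, Matrix.nonsing_inv_mul _ hP', Matrix.one_mul]

theorem trace_conj {P : Matrix n n ℝ} (hP : IsUnit P.det) (A : Matrix n n ℝ) :
    (P⁻¹ * A * P).trace = A.trace := by
  rw [Matrix.trace_mul_comm, ← Matrix.mul_assoc, Matrix.mul_nonsing_inv _ hP, Matrix.one_mul]

theorem trace_shapeMatrix_congruence {M : ℝ → Matrix n n ℝ} {r : ℝ}
    (hM : ∀ i j, DifferentiableAt ℝ (fun s ↦ M s i j) r) {P : Matrix n n ℝ} (hP : IsUnit P.det) :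
    (shapeMatrix (fun s ↦ Pᵀ * M s * P) r).trace = (shapeMatrix M r).trace := by
  rw [shapeMatrix_congruence hM hP, trace_conj hP]

theorem trace_shapeMatrix_sq_congruence {M : ℝ → Matrix n n ℝ} {r : ℝ}
    (hM : ∀ i j, DifferentiableAt ℝ (fun s ↦ M s i j) r) {P : Matrix n n ℝ} (hP : IsUnit P.det) :
    (shapeMatrix (fun s ↦ Pᵀ * M s * P) r * shapeMatrix (fun s ↦ Pᵀ * M s * P) r).trace =
      (shapeMatrix M r * shapeMatrix M r).trace := by
  rw [shapeMatrix_congruence hM hP, ← trace_conj hP (shapeMatrix M r * shapeMatrix M r)]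
  congr 1
  simp only [Matrix.mul_assoc]
  rw [← Matrix.mul_assoc P, Matrix.mul_nonsing_inv _ hP, Matrix.one_mul]

open scoped MatrixOrder Matrix.Norms.L2Operator in
/-- For a positive definite `γ`, `tr(γ⁻¹ T γ⁻¹ Tᵀ)` is the squared norm of `T`. -/
theorem trace_inv_mul_eq_sum_sq {γ : Matrix n n ℝ} (hγ : γ.PosDef) (T : Matrix n n ℝ) :
    0 ≤ (γ⁻¹ * T * γ⁻¹ * Tᵀ).trace ∧ ((γ⁻¹ * T * γ⁻¹ * Tᵀ).trace = 0 → T = 0) := by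
  obtain ⟨B, hB, h⟩ : ∃ B : Matrix n n ℝ, IsUnit B ∧ γ⁻¹ = Bᵀ * B := by
    simpa only [conjTranspose_eq_transpose_of_trivial, star_eq_conjTranspose] using
      CStarAlgebra.isStrictlyPositive_iff_eq_star_mul_self.1
        (Matrix.isStrictlyPositive_iff_posDef.2 hγ.inv)
  have key : (γ⁻¹ * T * γ⁻¹ * Tᵀ).trace = ((B * T * Bᵀ) * (B * T * Bᵀ)ᵀ).trace := by
    rw [h, Matrix.mul_assoc Bᵀ, Matrix.mul_assoc Bᵀ, Matrix.mul_assoc Bᵀ, Matrix.trace_mul_comm]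
    congr 1
    simp only [Matrix.mul_assoc, transpose_mul, transpose_transpose]
  rw [key, ← conjTranspose_eq_transpose_of_trivial (B * T * Bᵀ)]
  refine ⟨(posSemidef_self_mul_conjTranspose _).trace_nonneg, fun h0 ↦ ?_⟩
  rw [trace_mul_conjTranspose_self_eq_zero_iff] at h0
  have hB' : IsUnit Bᵀ := by simpa using hB
  rwa [hB'.mul_left_eq_zero, hB.mul_right_eq_zero] at h0

omit [Fintype n] [DecidableEq n] in
theorem transpose_matrixDeriv {M : ℝ → Matrix n n ℝ} (hM : ∀ s, (M s).IsSymm) (r : ℝ) :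
    (matrixDeriv M r)ᵀ = matrixDeriv M r := by
  ext i j
  simp only [matrixDeriv, transpose_apply, of_apply]
  congr 1
  exact funext fun s ↦ (hM s).apply i j

theorem trace_shapeMatrix_sq {M : ℝ → Matrix n n ℝ} (hM : ∀ s, (M s).IsSymm) (r : ℝ) :
    (shapeMatrix M r * shapeMatrix M r).trace =
      1 / 4 * ((M r)⁻¹ * matrixDeriv M r * (M r)⁻¹ * (matrixDeriv M r)ᵀ).trace := by
  rw [transpose_matrixDeriv hM]
  simp only [shapeMatrix, Matrix.smul_mul, Matrix.mul_smul, trace_smul, smul_eq_mul, Matrix.mul_assoc]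
  ring

end MatrixFamilies

section SmoothFamilies

open Matrix

variable {F : Type*} [NormedAddCommGroup F] [NormedSpace ℝ F] {T : Set F}

theorem hasFDerivWithinAt_slice {f : ℝ × F → ℝ} (hf : ContDiffOn ℝ ∞ f (Set.univ ×ˢ T))
    {y : F} (hy : y ∈ T) (r : ℝ) :
    HasDerivAt (fun s ↦ f (s, y)) (fderivWithin ℝ f (Set.univ ×ˢ T) (r, y) (1, 0)) r := by
  have h1 := ((hf.differentiableOn (by simp)) (r, y) ⟨trivial, hy⟩).hasFDerivWithinAt
  have h2 : HasDerivWithinAt (fun s : ℝ ↦ (s, y)) (1, 0) Set.univ r :=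
    (hasDerivWithinAt_id _ _).prodMk (hasDerivWithinAt_const _ _ _)
  have := h1.comp_hasDerivWithinAt r h2 (t := Set.univ ×ˢ T) (fun s _ ↦ Set.mk_mem_prod trivial hy)
  rwa [hasDerivWithinAt_univ] at this

theorem contDiffOn_deriv_slice {f : ℝ × F → ℝ} (hT : UniqueDiffOn ℝ T)
    (hf : ContDiffOn ℝ ∞ f (Set.univ ×ˢ T)) :
    ContDiffOn ℝ ∞ (fun z : ℝ × F ↦ deriv (fun s ↦ f (s, z.2)) z.1) (Set.univ ×ˢ T) := by
  have h := hf.fderivWithin (m := ∞) (uniqueDiffOn_univ.prod hT) (by simp)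
  exact (h.clm_apply (contDiffOn_const (c := ((1, 0) : ℝ × F)))).congr fun z hz ↦
    (hasFDerivWithinAt_slice hf hz.2 z.1).deriv

variable {n : Type*} [Fintype n] [DecidableEq n] {s : Set F}

theorem contDiffOn_det {A : F → Matrix n n ℝ} (hA : ∀ i j, ContDiffOn ℝ ∞ (fun z ↦ A z i j) s) :
    ContDiffOn ℝ ∞ (fun z ↦ (A z).det) s := by
  simp only [det_apply']
  exact ContDiffOn.sum fun σ _ ↦ contDiffOn_const.mul (contDiffOn_prod fun i _ ↦ hA _ _)

theorem contDiffOn_inv_apply {A : F → Matrix n n ℝ}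
    (hA : ∀ i j, ContDiffOn ℝ ∞ (fun z ↦ A z i j) s) (h0 : ∀ z ∈ s, (A z).det ≠ 0) (i j : n) :
    ContDiffOn ℝ ∞ (fun z ↦ (A z)⁻¹ i j) s := by
  simp only [inv_def, Matrix.smul_apply, smul_eq_mul, Ring.inverse_eq_inv', adjugate_def,
    cramer_transpose_apply, of_apply]
  refine ((contDiffOn_det hA).inv h0).mul (contDiffOn_det fun k l ↦ ?_)
  simp only [updateRow_apply]
  split_ifs
  · exact contDiffOn_const
  · exact hA k l

omit [DecidableEq n] in
theorem contDiffOn_mul_apply {A B : F → Matrix n n ℝ}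
    (hA : ∀ i j, ContDiffOn ℝ ∞ (fun z ↦ A z i j) s)
    (hB : ∀ i j, ContDiffOn ℝ ∞ (fun z ↦ B z i j) s) (i j : n) :
    ContDiffOn ℝ ∞ (fun z ↦ (A z * B z) i j) s := by
  simp only [Matrix.mul_apply]
  exact ContDiffOn.sum fun k _ ↦ (hA i k).mul (hB k j)

theorem contDiffOn_shapeMatrix_apply {M : ℝ → F → Matrix n n ℝ} (hT : UniqueDiffOn ℝ T)
    (hM : ∀ i j, ContDiffOn ℝ ∞ (fun z : ℝ × F ↦ M z.1 z.2 i j) (Set.univ ×ˢ T))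
    (h0 : ∀ r, ∀ y ∈ T, (M r y).det ≠ 0) (i j : n) :
    ContDiffOn ℝ ∞ (fun z : ℝ × F ↦ shapeMatrix (fun s ↦ M s z.2) z.1 i j) (Set.univ ×ˢ T) := by
  simp only [shapeMatrix, Matrix.smul_apply, smul_eq_mul]
  refine contDiffOn_const.mul (contDiffOn_mul_apply
    (contDiffOn_inv_apply hM fun z hz ↦ h0 _ _ hz.2) (fun k l ↦ ?_) i j)
  exact contDiffOn_deriv_slice hT (hM k l)

end SmoothFamilies

section CylinderCurvature

open Matrix

variable {d : ℕ} {H : Type*} [TopologicalSpace H]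
  {I : ModelWithCorners ℝ (EuclideanSpace ℝ (Fin d)) H} {N : Type*} [TopologicalSpace N]
  [ChartedSpace H N] [IsManifold I ∞ N]

omit [IsManifold I ∞ N] in
theorem extChartAt_cylinder_target (p : ℝ × N) :
    (extChartAt (𝓘(ℝ, ℝ).prod I) p).target = Set.univ ×ˢ (extChartAt I p.2).target := by
  rw [extChartAt_prod, extChartAt_model_space_eq_id]
  simp [-extChartAt]

omit [IsManifold I ∞ N] in
theorem extChartAt_cylinder_symm_apply (p : ℝ × N) (z : ℝ × EuclideanSpace ℝ (Fin d)) :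
    (extChartAt (𝓘(ℝ, ℝ).prod I) p).symm z = (z.1, (extChartAt I p.2).symm z.2) := by
  rw [extChartAt_prod, extChartAt_model_space_eq_id]
  simp [-extChartAt]

omit [IsManifold I ∞ N] in
theorem extChartAt_cylinder_apply (p q : ℝ × N) :
    extChartAt (𝓘(ℝ, ℝ).prod I) p q = (q.1, extChartAt I p.2 q.2) := by
  rw [extChartAt_prod, extChartAt_model_space_eq_id]
  simp [-extChartAt]

theorem range_cylinder_model :
    Set.range (𝓘(ℝ, ℝ).prod I) = Set.univ ×ˢ Set.range I := by
  rw [ModelWithCorners.range_prod]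
  simp

theorem mfderivWithin_cylinder_chart_symm (p : ℝ × N) {z : ℝ × EuclideanSpace ℝ (Fin d)}
    (hz : z.2 ∈ (extChartAt I p.2).target) (v : ℝ × EuclideanSpace ℝ (Fin d)) :
    mfderivWithin 𝓘(ℝ, ℝ × EuclideanSpace ℝ (Fin d)) (𝓘(ℝ, ℝ).prod I)
      (extChartAt (𝓘(ℝ, ℝ).prod I) p).symm (Set.range (𝓘(ℝ, ℝ).prod I)) z v =
      ((v.1, chartVector I p.2 v.2 z.2) : ℝ × EuclideanSpace ℝ (Fin d)) := by
  have hfun : ((extChartAt (𝓘(ℝ, ℝ).prod I) p).symm : ℝ × EuclideanSpace ℝ (Fin d) → ℝ × N) =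
      fun z ↦ (z.1, ((extChartAt I p.2).symm ∘ Prod.snd) z) :=
    funext (extChartAt_cylinder_symm_apply p)
  have h1 : HasMFDerivWithinAt 𝓘(ℝ, ℝ × EuclideanSpace ℝ (Fin d)) 𝓘(ℝ, ℝ)
      (Prod.fst : ℝ × EuclideanSpace ℝ (Fin d) → ℝ) (Set.univ ×ˢ Set.range I) z
      (ContinuousLinearMap.fst ℝ ℝ (EuclideanSpace ℝ (Fin d))) :=
    hasFDerivWithinAt_fst.hasMFDerivWithinAt
  have h2 : HasMFDerivWithinAt 𝓘(ℝ, ℝ × EuclideanSpace ℝ (Fin d))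
      𝓘(ℝ, EuclideanSpace ℝ (Fin d))
      (Prod.snd : ℝ × EuclideanSpace ℝ (Fin d) → _) (Set.univ ×ˢ Set.range I) z
      (ContinuousLinearMap.snd ℝ ℝ (EuclideanSpace ℝ (Fin d))) :=
    hasFDerivWithinAt_snd.hasMFDerivWithinAt
  have h3 := (mdifferentiableWithinAt_extChartAt_symm hz).hasMFDerivWithinAt
  have h4 := h1.prodMk (HasMFDerivWithinAt.comp z h3 h2 (fun w hw ↦ hw.2))
  have hu : UniqueMDiffWithinAt 𝓘(ℝ, ℝ × EuclideanSpace ℝ (Fin d))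
      (Set.univ ×ˢ Set.range I) z :=
    ((uniqueDiffOn_univ.prod I.uniqueDiffOn) z
      ⟨trivial, extChartAt_target_subset_range p.2 hz⟩).uniqueMDiffWithinAt
  rw [range_cylinder_model, hfun, h4.mfderivWithin hu]
  rfl

theorem metricMatrix_cylinder {g : CylinderMetric I N} {G : ℝ → SmoothMetric I N}
    (hg : IsRadialForm g G) (p : ℝ × N) {z : ℝ × EuclideanSpace ℝ (Fin d)}
    (hz : z.2 ∈ (extChartAt I p.2).target) :
    metricMatrix (cylinderBasis d) g p z =
      Matrix.fromBlocks 1 0 0 (metricMatrix (stdBasis d) (G z.1) p.2 z.2) := by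
  have key (a b : Unit ⊕ Fin d) : metricMatrix (cylinderBasis d) g p z a b =
      (cylinderBasis d a).1 * (cylinderBasis d b).1 +
      (G z.1).inner ((extChartAt I p.2).symm z.2)
        (chartVector I p.2 (cylinderBasis d a).2 z.2)
        (chartVector I p.2 (cylinderBasis d b).2 z.2) := by
    simp only [metricMatrix, of_apply]
    rw [mfderivWithin_cylinder_chart_symm p hz, mfderivWithin_cylinder_chart_symm p hz,
      extChartAt_cylinder_symm_apply]
    exact hg _ _ _ _
  have h0 : chartVector I p.2 (0 : EuclideanSpace ℝ (Fin d)) z.2 = 0 := map_zero _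
  have hr (w : TangentSpace I ((extChartAt I p.2).symm z.2)) :
      (G z.1).inner ((extChartAt I p.2).symm z.2) w 0 = 0 :=
    ContinuousLinearMap.map_zero _
  ext a b
  rw [key]
  rcases a with a | a <;> rcases b with b | b
  · simp [-extChartAt, cylinderBasis, h0]
  · simp [-extChartAt, cylinderBasis, h0]
  · simp [-extChartAt, cylinderBasis, h0, hr]
  · simp [-extChartAt, cylinderBasis]
    rfl

end CylinderCurvature

section RadialRicci

open Matrix

variable {d : ℕ} {H : Type*} [TopologicalSpace H]
  {I : ModelWithCorners ℝ (EuclideanSpace ℝ (Fin d)) H} {N : Type*} [TopologicalSpace N]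
  [ChartedSpace H N] [IsManifold I ∞ N]
  {g : CylinderMetric I N} {G : ℝ → SmoothMetric I N}

theorem contDiffOn_radial_metricMatrix (hg : IsRadialForm g G) (p : N) (i j : Fin d) :
    ContDiffOn ℝ ∞ (fun z : ℝ × EuclideanSpace ℝ (Fin d) ↦
      metricMatrix (stdBasis d) (G z.1) p z.2 i j) (Set.univ ×ˢ (extChartAt I p).target) := by
  have h := contDiffOn_metricMatrix (cylinderBasis d) g (0, p) (Sum.inr i) (Sum.inr j)
  rw [extChartAt_cylinder_target] at h
  refine h.congr fun z hz ↦ ?_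
  rw [metricMatrix_cylinder hg _ hz.2]
  rfl

omit [IsManifold I ∞ N] in
theorem coordDeriv_cylinder_eq (p : N) {z : ℝ × EuclideanSpace ℝ (Fin d)}
    (hz : z.2 ∈ (extChartAt I p).target) (i : Unit ⊕ Fin d)
    (f : ℝ × EuclideanSpace ℝ (Fin d) → ℝ) :
    coordDeriv (𝓘(ℝ, ℝ).prod I) (cylinderBasis d) i f z =
      fderivWithin ℝ f (Set.univ ×ˢ (extChartAt I p).target) z (cylinderBasis d i) := by
  have h : (Set.univ ×ˢ (extChartAt I p).target : Set (ℝ × EuclideanSpace ℝ (Fin d))) =ᶠ[𝓝 z]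
      Set.range (𝓘(ℝ, ℝ).prod I) := by
    have h1 := extChartAt_target_mem_nhdsWithin_of_mem (I := I) hz
    rw [mem_nhdsWithin_iff_eventually] at h1
    have h2 := (continuous_snd.tendsto z).eventually h1
    rw [range_cylinder_model]
    filter_upwards [h2] with w hw
    refine propext ⟨fun h ↦ ⟨trivial, extChartAt_target_subset_range p h.2⟩,
      fun h ↦ ⟨trivial, hw h.2⟩⟩
  rw [coordDeriv, fderivWithin_congr_set h]

omit [IsManifold I ∞ N] in
theorem coordDeriv_cylinder_congr (p : N) {z : ℝ × EuclideanSpace ℝ (Fin d)}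
    (hz : z.2 ∈ (extChartAt I p).target) (i : Unit ⊕ Fin d)
    {f₁ f₂ : ℝ × EuclideanSpace ℝ (Fin d) → ℝ}
    (h : ∀ w : ℝ × EuclideanSpace ℝ (Fin d), w.2 ∈ (extChartAt I p).target → f₁ w = f₂ w) :
    coordDeriv (𝓘(ℝ, ℝ).prod I) (cylinderBasis d) i f₁ z =
      coordDeriv (𝓘(ℝ, ℝ).prod I) (cylinderBasis d) i f₂ z := by
  rw [coordDeriv_cylinder_eq p hz, coordDeriv_cylinder_eq p hz,
    fderivWithin_congr (fun w hw ↦ h w hw.2) (h z hz)]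

omit [IsManifold I ∞ N] in
theorem coordDeriv_cylinder_of_eq_const (p : N) {z : ℝ × EuclideanSpace ℝ (Fin d)}
    (hz : z.2 ∈ (extChartAt I p).target) (i : Unit ⊕ Fin d)
    {f : ℝ × EuclideanSpace ℝ (Fin d) → ℝ} (c : ℝ)
    (h : ∀ w : ℝ × EuclideanSpace ℝ (Fin d), w.2 ∈ (extChartAt I p).target → f w = c) :
    coordDeriv (𝓘(ℝ, ℝ).prod I) (cylinderBasis d) i f z = 0 := by
  rw [coordDeriv_cylinder_congr p hz i (f₂ := fun _ ↦ c) h, coordDeriv, fderivWithin_fun_const]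
  rfl

omit [IsManifold I ∞ N] in
theorem coordDeriv_cylinder_radial (p : N) {z : ℝ × EuclideanSpace ℝ (Fin d)}
    (hz : z.2 ∈ (extChartAt I p).target) {f : ℝ × EuclideanSpace ℝ (Fin d) → ℝ}
    (hf : ContDiffOn ℝ ∞ f (Set.univ ×ˢ (extChartAt I p).target)) :
    coordDeriv (𝓘(ℝ, ℝ).prod I) (cylinderBasis d) (Sum.inl ()) f z =
      deriv (fun s ↦ f (s, z.2)) z.1 := by
  rw [coordDeriv_cylinder_eq p hz, (hasFDerivWithinAt_slice hf hz z.1).deriv]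
  simp [cylinderBasis]

theorem inv_metricMatrix_cylinder (hg : IsRadialForm g G) (p : ℝ × N)
    {z : ℝ × EuclideanSpace ℝ (Fin d)} (hz : z.2 ∈ (extChartAt I p.2).target) :
    (metricMatrix (cylinderBasis d) g p z)⁻¹ =
      Matrix.fromBlocks 1 0 0 (metricMatrix (stdBasis d) (G z.1) p.2 z.2)⁻¹ := by
  rw [metricMatrix_cylinder hg p hz]
  refine Matrix.inv_eq_right_inv ?_
  rw [Matrix.fromBlocks_multiply]
  have h : IsUnit (metricMatrix (stdBasis d) (G z.1) p.2 z.2).det :=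
    (metricMatrix_posDef _ _ _ hz).det_pos.ne'.isUnit
  simp [Matrix.mul_nonsing_inv _ h]

theorem coordDeriv_metricMatrix_inl_left (hg : IsRadialForm g G) (p : ℝ × N)
    {z : ℝ × EuclideanSpace ℝ (Fin d)} (hz : z.2 ∈ (extChartAt I p.2).target)
    (i j : Unit ⊕ Fin d) (u : Unit) :
    coordDeriv (𝓘(ℝ, ℝ).prod I) (cylinderBasis d) i
      (fun z ↦ metricMatrix (cylinderBasis d) g p z (Sum.inl u) j) z = 0 := by
  refine coordDeriv_cylinder_of_eq_const p.2 hz i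
    ((Matrix.fromBlocks 1 0 0 0 : Matrix (Unit ⊕ Fin d) (Unit ⊕ Fin d) ℝ) (Sum.inl u) j)
    fun w hw ↦ ?_
  rw [metricMatrix_cylinder hg p hw]
  cases j <;> rfl

theorem coordDeriv_metricMatrix_inl_right (hg : IsRadialForm g G) (p : ℝ × N)
    {z : ℝ × EuclideanSpace ℝ (Fin d)} (hz : z.2 ∈ (extChartAt I p.2).target)
    (i j : Unit ⊕ Fin d) (u : Unit) :
    coordDeriv (𝓘(ℝ, ℝ).prod I) (cylinderBasis d) i
      (fun z ↦ metricMatrix (cylinderBasis d) g p z j (Sum.inl u)) z = 0 := by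
  simp_rw [fun z ↦ (metricMatrix_isSymm (cylinderBasis d) g p z).apply (Sum.inl u) j]
  exact coordDeriv_metricMatrix_inl_left hg p hz i j u

theorem coordDeriv_metricMatrix_radial (hg : IsRadialForm g G) (p : ℝ × N)
    {z : ℝ × EuclideanSpace ℝ (Fin d)} (hz : z.2 ∈ (extChartAt I p.2).target)
    (i j : Fin d) :
    coordDeriv (𝓘(ℝ, ℝ).prod I) (cylinderBasis d) (Sum.inl ())
      (fun z ↦ metricMatrix (cylinderBasis d) g p z (Sum.inr i) (Sum.inr j)) z =
      matrixDeriv (fun s ↦ metricMatrix (stdBasis d) (G s) p.2 z.2) z.1 i j := by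
  rw [coordDeriv_cylinder_congr p.2 hz _
    (f₂ := fun z ↦ metricMatrix (stdBasis d) (G z.1) p.2 z.2 i j)
    (fun w hw ↦ by rw [metricMatrix_cylinder hg p hw]; rfl),
    coordDeriv_cylinder_radial p.2 hz (contDiffOn_radial_metricMatrix hg p.2 i j)]
  rfl

theorem christoffel_inl_inl (hg : IsRadialForm g G) (p : ℝ × N)
    {z : ℝ × EuclideanSpace ℝ (Fin d)} (hz : z.2 ∈ (extChartAt I p.2).target)
    (k : Unit ⊕ Fin d) :
    christoffel (cylinderBasis d) g p k (Sum.inl ()) (Sum.inl ()) z = 0 := by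
  simp [christoffel, coordDeriv_metricMatrix_inl_left hg p hz]

theorem christoffel_radial_upper (hg : IsRadialForm g G) (p : ℝ × N)
    {z : ℝ × EuclideanSpace ℝ (Fin d)} (hz : z.2 ∈ (extChartAt I p.2).target) (A : Fin d) :
    christoffel (cylinderBasis d) g p (Sum.inl ()) (Sum.inl ()) (Sum.inr A) z = 0 := by
  simp [christoffel, coordDeriv_metricMatrix_inl_left hg p hz,
    coordDeriv_metricMatrix_inl_right hg p hz, inv_metricMatrix_cylinder hg p hz]

theorem christoffel_radial_left (hg : IsRadialForm g G) (p : ℝ × N)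
    {z : ℝ × EuclideanSpace ℝ (Fin d)} (hz : z.2 ∈ (extChartAt I p.2).target) (A B : Fin d) :
    christoffel (cylinderBasis d) g p (Sum.inr B) (Sum.inl ()) (Sum.inr A) z =
      shapeMatrix (fun s ↦ metricMatrix (stdBasis d) (G s) p.2 z.2) z.1 B A := by
  rw [shapeMatrix, ← transpose_matrixDeriv (fun s ↦ metricMatrix_isSymm _ _ _ _)]
  simp [christoffel, coordDeriv_metricMatrix_inl_left hg p hz,
    coordDeriv_metricMatrix_inl_right hg p hz, inv_metricMatrix_cylinder hg p hz,
    coordDeriv_metricMatrix_radial hg p hz, Matrix.mul_apply]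

theorem christoffel_radial_right (hg : IsRadialForm g G) (p : ℝ × N)
    {z : ℝ × EuclideanSpace ℝ (Fin d)} (hz : z.2 ∈ (extChartAt I p.2).target) (A B : Fin d) :
    christoffel (cylinderBasis d) g p (Sum.inr B) (Sum.inr A) (Sum.inl ()) z =
      shapeMatrix (fun s ↦ metricMatrix (stdBasis d) (G s) p.2 z.2) z.1 B A := by
  rw [shapeMatrix, ← transpose_matrixDeriv (fun s ↦ metricMatrix_isSymm _ _ _ _)]
  simp [christoffel, coordDeriv_metricMatrix_inl_left hg p hz,
    coordDeriv_metricMatrix_inl_right hg p hz, inv_metricMatrix_cylinder hg p hz,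
    coordDeriv_metricMatrix_radial hg p hz, Matrix.mul_apply]

theorem contDiffOn_radial_shapeMatrix (hg : IsRadialForm g G) (p : N) (i j : Fin d) :
    ContDiffOn ℝ ∞ (fun z : ℝ × EuclideanSpace ℝ (Fin d) ↦
      shapeMatrix (fun s ↦ metricMatrix (stdBasis d) (G s) p z.2) z.1 i j)
      (Set.univ ×ˢ (extChartAt I p).target) :=
  contDiffOn_shapeMatrix_apply (uniqueDiffOn_extChartAt_target p)
    (contDiffOn_radial_metricMatrix hg p)
    (fun _ _ hy ↦ (metricMatrix_posDef _ _ _ hy).det_pos.ne') i j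

theorem weingarten_eq_shapeMatrix (hg : IsRadialForm g G) (r : ℝ) (x : N) :
    weingarten g (r, x) =
      shapeMatrix (fun s ↦ metricMatrix (stdBasis d) (G s) x (extChartAt I x x)) r := by
  ext B A
  rw [weingarten, of_apply, extChartAt_cylinder_apply]
  exact christoffel_radial_right hg (r, x) (z := (r, extChartAt I x x)) (mem_extChartAt_target x) A B

theorem radialRicci_eq (hg : IsRadialForm g G) (r : ℝ) (x : N) :
    radialRicci g (r, x) =
      - deriv (fun s ↦ (shapeMatrix (fun s ↦ metricMatrix (stdBasis d) (G s) x
          (extChartAt I x x)) s).trace) r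
      - (weingarten g (r, x) * weingarten g (r, x)).trace := by
  have hz : ((r, extChartAt I x x) : ℝ × EuclideanSpace ℝ (Fin d)).2 ∈
    (extChartAt I ((r, x) : ℝ × N).2).target := mem_extChartAt_target x
  have hrepr : radialRicci g (r, x) = ricciComponent (cylinderBasis d) g (r, x) (Sum.inl ())
      (Sum.inl ()) (r, extChartAt I x x) := by
    have e (i) : (cylinderBasis d).repr ((1, 0) : ℝ × EuclideanSpace ℝ (Fin d)) i =
        if i = Sum.inl () then 1 else 0 := by
      rcases i with i | i <;> simp [cylinderBasis]
    rw [radialRicci, ricci, extChartAt_cylinder_apply]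
    simp only [radialVector, e]
    simp
  have hA (k) : coordDeriv (𝓘(ℝ, ℝ).prod I) (cylinderBasis d) k
      (christoffel (cylinderBasis d) g (r, x) k (Sum.inl ()) (Sum.inl ()))
      (r, extChartAt I x x) = 0 :=
    coordDeriv_cylinder_of_eq_const x hz k 0 fun w hw ↦ christoffel_inl_inl hg (r, x) hw k
  have hB (A : Fin d) : coordDeriv (𝓘(ℝ, ℝ).prod I) (cylinderBasis d) (Sum.inl ())
      (christoffel (cylinderBasis d) g (r, x) (Sum.inr A) (Sum.inl ()) (Sum.inr A))
      (r, extChartAt I x x) = deriv (fun s ↦ shapeMatrix (fun s ↦ metricMatrix (stdBasis d) (G s) x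
          (extChartAt I x x)) s A A) r := by
    rw [coordDeriv_cylinder_congr x hz _
      (fun w hw ↦ christoffel_radial_left hg (r, x) (z := w) hw A A)]
    exact coordDeriv_cylinder_radial x hz (contDiffOn_radial_shapeMatrix hg x A A)
  have hderiv : deriv (fun s ↦ (shapeMatrix (fun s ↦ metricMatrix (stdBasis d) (G s) x
          (extChartAt I x x)) s).trace) r = ∑ A, deriv (fun s ↦ shapeMatrix (fun s ↦
          metricMatrix (stdBasis d) (G s) x (extChartAt I x x)) s A A) r := by
    simp only [Matrix.trace, Matrix.diag]
    exact deriv_fun_sum fun A _ ↦ (hasFDerivWithinAt_slice (contDiffOn_radial_shapeMatrix hg x A A)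
      (mem_extChartAt_target x) r).differentiableAt
  rw [hrepr, hderiv, ricciComponent, weingarten_eq_shapeMatrix hg]
  simp only [Fintype.sum_sum_type, Finset.univ_unique, Finset.sum_singleton, PUnit.default_eq_unit,
    hA, hB, christoffel_inl_inl hg (r, x) hz, christoffel_radial_upper hg (r, x) hz,
    christoffel_radial_left hg (r, x) hz]
  simp [Matrix.trace, Matrix.mul_apply, sub_eq_add_neg]

end RadialRicci

section LevelSets

open Matrix

variable {d : ℕ} {H : Type*} [TopologicalSpace H]
  {I : ModelWithCorners ℝ (EuclideanSpace ℝ (Fin d)) H} {N : Type*} [TopologicalSpace N]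
  [ChartedSpace H N] [IsManifold I ∞ N]
  {g : CylinderMetric I N} {G : ℝ → SmoothMetric I N}

theorem differentiableAt_radial_metricMatrix (hg : IsRadialForm g G) (p : N)
    {y : EuclideanSpace ℝ (Fin d)} (hy : y ∈ (extChartAt I p).target) (r : ℝ) (i j : Fin d) :
    DifferentiableAt ℝ (fun s ↦ metricMatrix (stdBasis d) (G s) p y i j) r :=
  (hasFDerivWithinAt_slice (contDiffOn_radial_metricMatrix hg p i j) hy r).differentiableAt

theorem fiberMatrix_eq (K : SmoothMetric I N) (x : N) :
    fiberMatrix K x = ((chartMatrix I x (extChartAt I x x))⁻¹)ᵀ *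
      metricMatrix (stdBasis d) K x (extChartAt I x x) * (chartMatrix I x (extChartAt I x x))⁻¹ := by
  have hP := isUnit_det_chartMatrix x (mem_extChartAt_target (I := I) x)
  have hP' : IsUnit ((chartMatrix I x (extChartAt I x x))ᵀ).det := by rwa [det_transpose]
  rw [metricMatrix_eq_fiberMatrix, extChartAt_to_inv, Matrix.transpose_nonsing_inv]
  simp only [Matrix.mul_assoc]
  rw [Matrix.mul_nonsing_inv _ hP, Matrix.mul_one, ← Matrix.mul_assoc,
    Matrix.nonsing_inv_mul _ hP', Matrix.one_mul]

theorem differentiable_fiberMatrix (hg : IsRadialForm g G) (x : N) (i j : Fin d) :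
    Differentiable ℝ (fun s ↦ fiberMatrix (G s) x i j) := by
  intro r
  simp only [fiberMatrix_eq]
  exact differentiableAt_mul_mul
    (differentiableAt_radial_metricMatrix hg x (mem_extChartAt_target x) r) _ _ i j

theorem metricMatrix_chart_eq (G : ℝ → SmoothMetric I N) (p : N) {x : N}
    (hx : x ∈ (extChartAt I p).source) :
    (fun s ↦ metricMatrix (stdBasis d) (G s) p (extChartAt I p x)) = fun s ↦
      (chartMatrix I p (extChartAt I p x))ᵀ * fiberMatrix (G s) x *
        chartMatrix I p (extChartAt I p x) := by
  funext s
  rw [metricMatrix_eq_fiberMatrix, (extChartAt I p).left_inv hx]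

theorem meanCurvature_eq_fiber (hg : IsRadialForm g G) (r : ℝ) (x : N) :
    meanCurvature g (r, x) = (shapeMatrix (fun s ↦ fiberMatrix (G s) x) r).trace := by
  rw [meanCurvature, weingarten_eq_shapeMatrix hg,
    metricMatrix_chart_eq G x (mem_extChartAt_source x)]
  exact trace_shapeMatrix_congruence (fun i j ↦ differentiable_fiberMatrix hg x i j r)
    (isUnit_det_chartMatrix x (mem_extChartAt_target x))

theorem trace_weingarten_sq_eq_fiber (hg : IsRadialForm g G) (r : ℝ) (x : N) :
    (weingarten g (r, x) * weingarten g (r, x)).trace =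
      (shapeMatrix (fun s ↦ fiberMatrix (G s) x) r *
        shapeMatrix (fun s ↦ fiberMatrix (G s) x) r).trace := by
  rw [weingarten_eq_shapeMatrix hg, metricMatrix_chart_eq G x (mem_extChartAt_source x)]
  exact trace_shapeMatrix_sq_congruence (fun i j ↦ differentiable_fiberMatrix hg x i j r)
    (isUnit_det_chartMatrix x (mem_extChartAt_target x))

theorem meanCurvature_eq_chart (hg : IsRadialForm g G) (p : N) (r : ℝ) {x : N}
    (hx : x ∈ (extChartAt I p).source) :
    meanCurvature g (r, x) = (shapeMatrix (fun s ↦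
      metricMatrix (stdBasis d) (G s) p (extChartAt I p x)) r).trace := by
  rw [meanCurvature_eq_fiber hg, metricMatrix_chart_eq G p hx]
  exact (trace_shapeMatrix_congruence (fun i j ↦ differentiable_fiberMatrix hg x i j r)
    (isUnit_det_chartMatrix p ((extChartAt I p).map_source hx))).symm

theorem trace_weingarten_sq_eq_chart (hg : IsRadialForm g G) (p : N) (r : ℝ) {x : N}
    (hx : x ∈ (extChartAt I p).source) :
    (weingarten g (r, x) * weingarten g (r, x)).trace =
      (shapeMatrix (fun s ↦ metricMatrix (stdBasis d) (G s) p (extChartAt I p x)) r *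
        shapeMatrix (fun s ↦ metricMatrix (stdBasis d) (G s) p (extChartAt I p x)) r).trace := by
  rw [trace_weingarten_sq_eq_fiber hg, metricMatrix_chart_eq G p hx]
  exact (trace_shapeMatrix_sq_congruence (fun i j ↦ differentiable_fiberMatrix hg x i j r)
    (isUnit_det_chartMatrix p ((extChartAt I p).map_source hx))).symm

theorem contDiffOn_radial_trace_shapeMatrix (hg : IsRadialForm g G) (p : N) :
    ContDiffOn ℝ ∞ (fun z : ℝ × EuclideanSpace ℝ (Fin d) ↦
      (shapeMatrix (fun s ↦ metricMatrix (stdBasis d) (G s) p z.2) z.1).trace)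
      (Set.univ ×ˢ (extChartAt I p).target) := by
  simp only [Matrix.trace, Matrix.diag]
  exact ContDiffOn.sum fun A _ ↦ contDiffOn_radial_shapeMatrix hg p A A

theorem differentiable_meanCurvature (hg : IsRadialForm g G) (x : N) :
    Differentiable ℝ (fun s ↦ meanCurvature g (s, x)) := by
  intro r
  simp only [fun s ↦ meanCurvature_eq_chart hg x s (mem_extChartAt_source x)]
  exact (hasFDerivWithinAt_slice (contDiffOn_radial_trace_shapeMatrix hg x)
    (mem_extChartAt_target x) r).differentiableAt

theorem deriv_meanCurvature (hg : IsRadialForm g G) (r : ℝ) (x : N) :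
    deriv (fun s ↦ meanCurvature g (s, x)) r =
      -(radialRicci g (r, x) + (weingarten g (r, x) * weingarten g (r, x)).trace) := by
  rw [radialRicci_eq hg]
  simp only [fun s ↦ meanCurvature_eq_chart hg x s (mem_extChartAt_source x)]
  ring

omit [IsManifold I ∞ N] in
theorem continuous_of_chart {F : ℝ × N → ℝ} (f : N → ℝ × EuclideanSpace ℝ (Fin d) → ℝ)
    (hf : ∀ p, ContinuousOn (f p) (Set.univ ×ˢ (extChartAt I p).target))
    (hF : ∀ p r, ∀ x ∈ (extChartAt I p).source, F (r, x) = f p (r, extChartAt I p x)) :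
    Continuous F := by
  rw [continuous_iff_continuousAt]
  rintro ⟨r, p⟩
  have hopen : (Set.univ ×ˢ (extChartAt I p).source : Set (ℝ × N)) ∈ 𝓝 (r, p) :=
    prod_mem_nhds Filter.univ_mem (extChartAt_source_mem_nhds p)
  have h : ContinuousOn (fun q : ℝ × N ↦ f p (q.1, extChartAt I p q.2))
      (Set.univ ×ˢ (extChartAt I p).source) := by
    refine (hf p).comp (continuousOn_fst.prodMk ((continuousOn_extChartAt p).comp continuousOn_snd
      fun q hq ↦ hq.2)) fun q hq ↦ ⟨trivial, (extChartAt I p).map_source hq.2⟩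
  exact (h.congr fun q hq ↦ hF p q.1 q.2 hq.2).continuousAt hopen

theorem continuous_meanCurvature (hg : IsRadialForm g G) : Continuous (meanCurvature g) :=
  continuous_of_chart (I := I) _
    (fun p ↦ (contDiffOn_radial_trace_shapeMatrix hg p).continuousOn)
    fun p r _ hx ↦ meanCurvature_eq_chart hg p r hx

theorem continuous_trace_weingarten_sq (hg : IsRadialForm g G) :
    Continuous fun q : ℝ × N ↦ (weingarten g q * weingarten g q).trace := by
  refine continuous_of_chart (I := I) (fun p z ↦
      (shapeMatrix (fun s ↦ metricMatrix (stdBasis d) (G s) p z.2) z.1 *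
        shapeMatrix (fun s ↦ metricMatrix (stdBasis d) (G s) p z.2) z.1).trace)
    (fun p ↦ ?_) fun p r x hx ↦ trace_weingarten_sq_eq_chart hg p r hx
  simp only [Matrix.trace, Matrix.diag]
  exact (ContDiffOn.sum fun A _ ↦ contDiffOn_mul_apply
    (contDiffOn_radial_shapeMatrix hg p) (contDiffOn_radial_shapeMatrix hg p) A A).continuousOn

theorem continuous_radialRicci (hg : IsRadialForm g G) : Continuous (radialRicci g) := by
  have h : Continuous fun q : ℝ × N ↦ deriv (fun s ↦ meanCurvature g (s, q.2)) q.1 := by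
    refine continuous_of_chart (I := I) (fun p z ↦ deriv (fun s ↦ (shapeMatrix (fun s ↦
      metricMatrix (stdBasis d) (G s) p z.2) s).trace) z.1) (fun p ↦ ?_) fun p r x hx ↦ ?_
    · exact (contDiffOn_deriv_slice (uniqueDiffOn_extChartAt_target p)
        (contDiffOn_radial_trace_shapeMatrix hg p)).continuousOn
    · simp only [fun s ↦ meanCurvature_eq_chart hg p s hx]
  have h2 := (h.add (continuous_trace_weingarten_sq hg)).neg
  refine h2.congr fun q ↦ ?_
  simp only [Pi.neg_apply, Pi.add_apply, deriv_meanCurvature hg]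
  ring

theorem fiberMatrix_posDef (K : SmoothMetric I N) (x : N) : (fiberMatrix K x).PosDef := by
  have hP := isUnit_det_chartMatrix x (mem_extChartAt_target (I := I) x)
  rw [fiberMatrix_eq, ← conjTranspose_eq_transpose_of_trivial]
  refine (metricMatrix_posDef _ _ _ (mem_extChartAt_target x)).conjTranspose_mul_mul_same ?_
  rw [Matrix.mulVec_injective_iff_isUnit, Matrix.isUnit_nonsing_inv_iff, Matrix.isUnit_iff_isUnit_det]
  exact hP

theorem fiberMatrix_isSymm (K : SmoothMetric I N) (x : N) : (fiberMatrix K x).IsSymm := by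
  ext i j
  exact K.symm _ _ _

theorem trace_weingarten_sq_nonneg (hg : IsRadialForm g G) (q : ℝ × N) :
    0 ≤ (weingarten g q * weingarten g q).trace := by
  obtain ⟨r, x⟩ := q
  rw [trace_weingarten_sq_eq_fiber hg, trace_shapeMatrix_sq fun s ↦ fiberMatrix_isSymm _ _]
  have := (trace_inv_mul_eq_sum_sq (fiberMatrix_posDef (G r) x)
    (matrixDeriv (fun s ↦ fiberMatrix (G s) x) r)).1
  positivity

theorem fiberMatrix_eq_of_trace_weingarten_sq (hg : IsRadialForm g G) {x : N}
    (h : ∀ r, (weingarten g (r, x) * weingarten g (r, x)).trace = 0) (r s : ℝ) :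
    fiberMatrix (G r) x = fiberMatrix (G s) x := by
  ext i j
  refine is_const_of_deriv_eq_zero (differentiable_fiberMatrix hg x i j) (fun t ↦ ?_) r s
  have ht := h t
  rw [trace_weingarten_sq_eq_fiber hg, trace_shapeMatrix_sq fun s ↦ fiberMatrix_isSymm _ _,
    mul_eq_zero_iff_left (by norm_num)] at ht
  exact congrFun₂ ((trace_inv_mul_eq_sum_sq (fiberMatrix_posDef (G t) x) _).2 ht) i j

theorem inner_eq_of_fiberMatrix_eq {K L : SmoothMetric I N} {x : N}
    (h : fiberMatrix K x = fiberMatrix L x) (u v : TangentSpace I x) :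
    K.inner x u v = L.inner x u v := by
  have key (K : SmoothMetric I N) : K.inner x u v =
      ∑ i, ∑ j, (stdBasis d).repr u i * (stdBasis d).repr v j * fiberMatrix K x i j := by
    have e (u : TangentSpace I x) : u = ∑ k, (stdBasis d).repr u k •
      (show TangentSpace I x from stdBasis d k) := ((stdBasis d).sum_repr u).symm
    conv_lhs => rw [e u, e v]
    exact ContinuousLinearMap.apply_sum_smul_sum_smul _ _ _ _ _
  rw [key, key, h]

theorem IsWarpedProduct.isRadialForm_const {K : SmoothMetric I N}
    (h : IsWarpedProduct g (fun _ ↦ 1) K) : IsRadialForm g fun _ ↦ K := by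
  intro r x u v
  simpa using h r x u v

theorem IsWarpedProduct.weingarten_eq_zero {K : SmoothMetric I N}
    (h : IsWarpedProduct g (fun _ ↦ 1) K) (q : ℝ × N) : weingarten g q = 0 := by
  obtain ⟨r, x⟩ := q
  rw [weingarten_eq_shapeMatrix h.isRadialForm_const, shapeMatrix]
  have : matrixDeriv (fun _ ↦ metricMatrix (stdBasis d) K x (extChartAt I x x)) r = 0 := by
    ext i j
    simp [matrixDeriv]
  rw [this]
  simp

theorem isWarpedProduct_of_trace_weingarten_sq (hg : IsRadialForm g G)
    (h : ∀ q, (weingarten g q * weingarten g q).trace = 0) :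
    IsWarpedProduct g (fun _ ↦ 1) (G 0) := by
  intro r x u v
  have e : (G r).inner x u.2 v.2 = (G 0).inner x u.2 v.2 := inner_eq_of_fiberMatrix_eq
    (fiberMatrix_eq_of_trace_weingarten_sq hg (fun r ↦ h (r, x)) r 0) _ _
  rw [hg, e]
  simp

end LevelSets

section VolumeMeasure

variable {d : ℕ} {H : Type*} [TopologicalSpace H]
  {I : ModelWithCorners ℝ (EuclideanSpace ℝ (Fin d)) H} {N : Type*} [TopologicalSpace N]
  [ChartedSpace H N] [IsManifold I ∞ N]

omit [IsManifold I ∞ N] in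
theorem measurableSet_extChartAt_target (c : N) : MeasurableSet (extChartAt I c).target := by
  rw [extChartAt_target]
  exact ((chartAt H c).open_target.preimage I.continuous_symm).measurableSet.inter
    I.isClosed_range.measurableSet

variable [T2Space N] [SigmaCompactSpace N]

/-- The density of `ρ_c dμ_K` in the chart centred at `c`. -/
def chartDensity (K : SmoothMetric I N) (c : N) (y : EuclideanSpace ℝ (Fin d)) : ℝ :=
  chartPartition I N c ((extChartAt I c).symm y) * Real.sqrt (metricMatrix (stdBasis d) K c y).det

theorem continuousOn_chartDensity (K : SmoothMetric I N) (c : N) :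
    ContinuousOn (chartDensity K c) (extChartAt I c).target :=
  ((chartPartition I N c).contMDiff.continuous.comp_continuousOn
    (continuousOn_extChartAt_symm c)).mul
    (contDiffOn_det fun i j ↦ contDiffOn_metricMatrix (stdBasis d) K c i j).continuousOn.sqrt

theorem aemeasurable_chartDensity (K : SmoothMetric I N) (c : N) :
    AEMeasurable (fun y ↦ ENNReal.ofReal (chartDensity K c y))
      (volume.restrict (extChartAt I c).target) :=
  ((continuousOn_chartDensity K c).aemeasurable (measurableSet_extChartAt_target c)).ennreal_ofReal

theorem chartPartition_tsupport_subset (c : N) :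
    tsupport (chartPartition I N c) ⊆ (extChartAt I c).source := by
  rw [extChartAt_source]
  exact Classical.choose_spec (SmoothPartitionOfUnity.exists_isSubordinate_chartAt_source I N) c

theorem lintegral_chartDensity_lt_top [CompactSpace N] (K : SmoothMetric I N) (c : N) :
    ∫⁻ y in (extChartAt I c).target, ENNReal.ofReal (chartDensity K c y) < ⊤ := by
  set S := extChartAt I c '' tsupport (chartPartition I N c) with hS
  have hsub := chartPartition_tsupport_subset (I := I) c
  have hScomp : IsCompact S :=
    (isClosed_tsupport _).isCompact.image_of_continuousOn ((continuousOn_extChartAt c).mono hsub)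
  have hST : S ⊆ (extChartAt I c).target := by
    rintro _ ⟨x, hx, rfl⟩
    exact (extChartAt I c).map_source (hsub hx)
  have hzero : ∀ y ∈ (extChartAt I c).target, y ∉ S → chartDensity K c y = 0 := by
    intro y hy hyS
    rw [chartDensity, image_eq_zero_of_notMem_tsupport (f := chartPartition I N c)
      fun h ↦ hyS ⟨_, h, (extChartAt I c).right_inv hy⟩, zero_mul]
  obtain ⟨C, hC⟩ := hScomp.exists_bound_of_continuousOn ((continuousOn_chartDensity K c).mono hST)
  calc ∫⁻ y in (extChartAt I c).target, ENNReal.ofReal (chartDensity K c y)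
      ≤ ∫⁻ y in (extChartAt I c).target, S.indicator (fun _ ↦ ENNReal.ofReal C) y := by
        refine setLIntegral_mono' (measurableSet_extChartAt_target c) fun y hy ↦ ?_
        by_cases hyS : y ∈ S
        · rw [Set.indicator_of_mem hyS]
          exact ENNReal.ofReal_le_ofReal ((le_abs_self _).trans (hC y hyS))
        · rw [hzero y hy hyS]
          simp
    _ ≤ ∫⁻ y, S.indicator (fun _ ↦ ENNReal.ofReal C) y := setLIntegral_le_lintegral _ _
    _ = ENNReal.ofReal C * volume S := lintegral_indicator_const hScomp.measurableSet _
    _ < ⊤ := ENNReal.mul_lt_top ENNReal.ofReal_lt_top hScomp.measure_lt_top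

variable [MeasurableSpace N] [BorelSpace N]

theorem aemeasurable_extChartAt_symm (K : SmoothMetric I N) (c : N) :
    AEMeasurable (extChartAt I c).symm ((volume.restrict (extChartAt I c).target).withDensity
      fun y ↦ ENNReal.ofReal (chartDensity K c y)) :=
  ((continuousOn_extChartAt_symm c).aemeasurable (measurableSet_extChartAt_target c)).mono_ac
    (withDensity_absolutelyContinuous _ _)

theorem isFiniteMeasure_riemannianVolume [CompactSpace N] (K : SmoothMetric I N) :
    IsFiniteMeasure (riemannianVolume K) := by
  refine ⟨?_⟩
  have hmass (c : N) : Measure.map (extChartAt I c).symm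
      ((volume.restrict (extChartAt I c).target).withDensity fun y ↦
        ENNReal.ofReal (chartDensity K c y)) Set.univ =
      ∫⁻ y in (extChartAt I c).target, ENNReal.ofReal (chartDensity K c y) := by
    rw [Measure.map_apply_of_aemeasurable (aemeasurable_extChartAt_symm K c) MeasurableSet.univ,
      Set.preimage_univ, withDensity_apply _ MeasurableSet.univ, Measure.restrict_univ]
  have hfin := (chartPartition I N).locallyFinite.finite_nonempty_of_compact
  have hsum : riemannianVolume K Set.univ =
      ∑' c : N, ∫⁻ y in (extChartAt I c).target, ENNReal.ofReal (chartDensity K c y) := by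
    rw [riemannianVolume, Measure.sum_apply _ MeasurableSet.univ]
    exact tsum_congr hmass
  rw [hsum, tsum_eq_sum (s := hfin.toFinset)]
  · exact ENNReal.sum_lt_top.2 fun c _ ↦ lintegral_chartDensity_lt_top K c
  · intro c hc
    have h0 : ∀ x, chartPartition I N c x = 0 := by
      simpa [Set.Nonempty] using hc
    simp [chartDensity, h0]

theorem isOpenPosMeasure_riemannianVolume (K : SmoothMetric I N) :
    (riemannianVolume K).IsOpenPosMeasure := by
  refine ⟨fun U hU ⟨x, hx⟩ ↦ ?_⟩
  obtain ⟨c, hc⟩ := (chartPartition I N).exists_pos_of_mem (Set.mem_univ x)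
  have hxs : x ∈ (extChartAt I c).source :=
    chartPartition_tsupport_subset c (subset_tsupport _ hc.ne')
  have hxt := (extChartAt I c).map_source hxs
  intro h0
  have h1 : Measure.map (extChartAt I c).symm
      ((volume.restrict (extChartAt I c).target).withDensity fun y ↦
        ENNReal.ofReal (chartDensity K c y)) U = 0 :=
    le_antisymm ((Measure.le_sum (fun c : N ↦ Measure.map (extChartAt I c).symm
      ((volume.restrict (extChartAt I c).target).withDensity fun y ↦
        ENNReal.ofReal (chartDensity K c y))) c U).trans h0.le) zero_le
  rw [Measure.map_apply_of_aemeasurable (aemeasurable_extChartAt_symm K c) hU.measurableSet,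
    withDensity_apply_eq_zero' (aemeasurable_chartDensity K c)] at h1
  have h2 := le_antisymm ((Measure.le_restrict_apply _ _).trans h1.le) zero_le
  have hV : {y | 0 < chartPartition I N c ((extChartAt I c).symm y)} ∩
      (extChartAt I c).symm ⁻¹' U ∩ (extChartAt I c).target ∈
      𝓝[Set.range I] (extChartAt I c x) := by
    have hcont : ContinuousWithinAt (extChartAt I c).symm (Set.range I) (extChartAt I c x) :=
      (continuousOn_extChartAt_symm c _ hxt).mono_of_mem_nhdsWithin
        (extChartAt_target_mem_nhdsWithin_of_mem hxt)
    have hinv := (extChartAt I c).left_inv hxs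
    refine inter_mem (inter_mem ?_ ?_) (extChartAt_target_mem_nhdsWithin_of_mem hxt)
    · refine hcont (IsOpen.mem_nhds (s := {z | 0 < chartPartition I N c z})
        (isOpen_lt continuous_const (chartPartition I N c).contMDiff.continuous) ?_)
      simpa only [Set.mem_ofPred_eq, hinv] using hc
    · refine hcont (hU.mem_nhds ?_)
      rwa [hinv]
  obtain ⟨W, hWo, hxW, hW⟩ := mem_nhdsWithin.1 hV
  obtain ⟨y, hyW, hyI⟩ := mem_closure_iff.1 (I.range_subset_closure_interior
    (extChartAt_target_subset_range c hxt)) W hWo hxW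
  refine ((hWo.inter isOpen_interior).measure_pos volume ⟨y, hyW, hyI⟩).ne'
    (measure_mono_null (fun z hz ↦ ?_) h2)
  obtain ⟨⟨hz1, hz2⟩, hz3⟩ := hW ⟨hz.1, interior_subset hz.2⟩
  refine ⟨⟨?_, hz2⟩, hz3⟩
  exact (ENNReal.ofReal_pos.2 (mul_pos hz1 (Real.sqrt_pos.2
    (metricMatrix_posDef _ _ _ hz3).det_pos))).ne'

end VolumeMeasure

section Slabs

variable {N : Type*} [TopologicalSpace N] [CompactSpace N] [MeasurableSpace N] [BorelSpace N]
  {μ : Measure N} [IsFiniteMeasure μ]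

theorem Continuous.integrable_of_compactSpace {f : N → ℝ} (hf : Continuous f) : Integrable f μ := by
  rw [← integrableOn_univ]
  exact hf.continuousOn.integrableOn_compact' isCompact_univ MeasurableSet.univ

theorem Continuous.integrableOn_slab {F : ℝ × N → ℝ} (hF : Continuous F) (a b : ℝ) :
    IntegrableOn F (Set.Ioc a b ×ˢ Set.univ) (volume.prod μ) := by
  refine IntegrableOn.mono_set (t := Set.Icc a b ×ˢ Set.univ) ?_
    (Set.prod_mono_left Set.Ioc_subset_Icc_self)
  exact hF.continuousOn.integrableOn_compact' (isCompact_Icc.prod isCompact_univ)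
    (measurableSet_Icc.prod MeasurableSet.univ)

/-- The fundamental theorem of calculus in the direction of `ℝ`, integrated over `N`. -/
theorem integral_sub_eq_setIntegral_slab {f F : ℝ × N → ℝ} (hf : Continuous f) (hF : Continuous F)
    (hderiv : ∀ r x, HasDerivAt (fun s ↦ f (s, x)) (F (r, x)) r) {a b : ℝ} (hab : a ≤ b) :
    ∫ x, f (b, x) ∂μ - ∫ x, f (a, x) ∂μ =
      ∫ q in Set.Ioc a b ×ˢ Set.univ, F q ∂(volume.prod μ) := by
  have hslice (r : ℝ) : Integrable (fun x ↦ f (r, x)) μ :=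
    (hf.comp (Continuous.prodMk_right r)).integrable_of_compactSpace
  have hint : Integrable F (((volume : Measure ℝ).restrict (Set.Ioc a b)).prod μ) := by
    have h := hF.integrableOn_slab (μ := μ) a b
    rwa [IntegrableOn, ← Measure.prod_restrict, Measure.restrict_univ] at h
  rw [← integral_sub (hslice b) (hslice a), ← Measure.prod_restrict, Measure.restrict_univ,
    integral_prod_symm _ hint]
  refine integral_congr_ae (Eventually.of_forall fun x ↦ ?_)
  have := intervalIntegral.integral_eq_sub_of_hasDerivAt (a := a) (b := b)
    (fun r _ ↦ hderiv r x) ((hF.comp (Continuous.prodMk_left x)).intervalIntegrable a b)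
  rw [intervalIntegral.integral_of_le hab] at this
  exact this.symm

end Slabs

section SlabExhaustion

variable {N : Type*}

theorem monotone_slab :
    Monotone fun n : ℕ ↦ (Set.Ioc (-n : ℝ) n ×ˢ Set.univ : Set (ℝ × N)) := by
  intro m n hmn
  have : (m : ℝ) ≤ n := by exact_mod_cast hmn
  exact Set.prod_mono_left (Set.Ioc_subset_Ioc (by linarith) this)

theorem iUnion_slab :
    ⋃ n : ℕ, (Set.Ioc (-n : ℝ) n ×ˢ Set.univ : Set (ℝ × N)) = Set.univ := by
  refine Set.eq_univ_of_forall fun q ↦ Set.mem_iUnion.2 ?_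
  obtain ⟨n, hn⟩ := exists_nat_gt |q.1|
  exact ⟨n, ⟨(abs_lt.1 hn).1, (abs_lt.1 hn).2.le⟩, trivial⟩

end SlabExhaustion

section MassFormula

variable {d : ℕ} {H : Type*} [TopologicalSpace H]
  {I : ModelWithCorners ℝ (EuclideanSpace ℝ (Fin d)) H} {N : Type*} [TopologicalSpace N]
  [ChartedSpace H N] [IsManifold I ∞ N]

theorem radialMass_of_product {K : SmoothMetric I N} {g₀ : CylinderMetric I N}
    (hg₀ : IsWarpedProduct g₀ (fun _ ↦ 1) K) (g : CylinderMetric I N) (q : ℝ × N) :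
    radialMass (fun _ ↦ 1) g₀ g q = -meanCurvature g q := by
  simp [radialMass, meanCurvature, hg₀.weingarten_eq_zero q]

variable [CompactSpace N] [T2Space N] [MeasurableSpace N] [BorelSpace N]

theorem totalRadialMass_sub {Ghat : SmoothMetric I N} {g₀ : CylinderMetric I N}
    (hg₀ : IsWarpedProduct g₀ (fun _ ↦ 1) Ghat) {G : ℝ → SmoothMetric I N} {g : CylinderMetric I N}
    (hg : IsRadialForm g G) {a b : ℝ} (hab : a ≤ b) :
    totalRadialMass (fun _ ↦ 1) Ghat g₀ g b - totalRadialMass (fun _ ↦ 1) Ghat g₀ g a =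
      ∫ q in Set.Ioc a b ×ˢ Set.univ, radialRicci g q
        ∂((volume : Measure ℝ).prod (riemannianVolume Ghat)) +
      ∫ q in Set.Ioc a b ×ˢ Set.univ, (weingarten g q * weingarten g q).trace
        ∂((volume : Measure ℝ).prod (riemannianVolume Ghat)) := by
  have := isFiniteMeasure_riemannianVolume Ghat
  rw [← integral_add ((continuous_radialRicci hg).integrableOn_slab a b)
    ((continuous_trace_weingarten_sq hg).integrableOn_slab a b)]
  simp only [totalRadialMass, radialMass_of_product hg₀]
  refine integral_sub_eq_setIntegral_slab (f := fun q ↦ -meanCurvature g q)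
    (continuous_meanCurvature hg).neg
    ((continuous_radialRicci hg).add (continuous_trace_weingarten_sq hg)) (fun r x ↦ ?_) hab
  have h := (differentiable_meanCurvature hg x r).hasDerivAt.neg
  rwa [deriv_meanCurvature hg, neg_neg] at h

theorem tendsto_setIntegral_trace_weingarten_sq {Ghat : SmoothMetric I N} {g₀ : CylinderMetric I N}
    (hg₀ : IsWarpedProduct g₀ (fun _ ↦ 1) Ghat) {G : ℝ → SmoothMetric I N} {g : CylinderMetric I N}
    (hg : IsRadialForm g G) {massBot massTop : ℝ}
    (hBot : Tendsto (totalRadialMass (fun _ ↦ 1) Ghat g₀ g) atBot (𝓝 massBot))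
    (hTop : Tendsto (totalRadialMass (fun _ ↦ 1) Ghat g₀ g) atTop (𝓝 massTop))
    (hRic : Integrable (radialRicci g) ((volume : Measure ℝ).prod (riemannianVolume Ghat))) :
    Tendsto (fun n : ℕ ↦ ∫ q in Set.Ioc (-n : ℝ) n ×ˢ Set.univ,
        (weingarten g q * weingarten g q).trace
        ∂((volume : Measure ℝ).prod (riemannianVolume Ghat))) atTop
      (𝓝 (massTop - massBot - ∫ q, radialRicci g q
        ∂((volume : Measure ℝ).prod (riemannianVolume Ghat)))) := by
  have h1 := tendsto_setIntegral_of_monotone (fun n ↦ measurableSet_Ioc.prod MeasurableSet.univ)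
    monotone_slab (f := radialRicci g) hRic.integrableOn
  rw [iUnion_slab, setIntegral_univ] at h1
  have hnat := tendsto_natCast_atTop_atTop (R := ℝ)
  refine (((hTop.comp hnat).sub (hBot.comp (tendsto_neg_atTop_atBot.comp hnat))).sub h1).congr
    fun n ↦ ?_
  have hn : (-n : ℝ) ≤ n := by
    have : (0 : ℝ) ≤ n := n.cast_nonneg
    linarith
  simp only [Function.comp_apply, totalRadialMass_sub hg₀ hg hn]
  ring

end MassFormula

section Rigidity

variable {d : ℕ} {H : Type*} [TopologicalSpace H]
  {I : ModelWithCorners ℝ (EuclideanSpace ℝ (Fin d)) H} {N : Type*} [TopologicalSpace N]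
  [ChartedSpace H N] [IsManifold I ∞ N]

theorem comap_coe_nhds_neBot (r₀ : EReal) : (comap (fun t : ℝ ↦ (t : EReal)) (𝓝 r₀)).NeBot := by
  have h : Dense (Set.range fun t : ℝ ↦ (t : EReal)) := dense_of_exists_between fun a b hab ↦ by
    obtain ⟨t, ht⟩ := EReal.lt_iff_exists_real_btwn.1 hab
    exact ⟨t, ⟨t, rfl⟩, ht⟩
  exact comap_neBot_iff_frequently.2 (mem_closure_iff_frequently.1 (h r₀))

theorem eq_zero_of_tensorNorm_eq_zero {γ T : Matrix (Fin d) (Fin d) ℝ} (hγ : γ.PosDef)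
    (h : tensorNorm γ T = 0) : T = 0 := by
  obtain ⟨h1, h2⟩ := trace_inv_mul_eq_sum_sq hγ T
  exact h2 ((Real.sqrt_eq_zero h1).1 h)

theorem IsRadialForm.fiberMatrix_eq_of_product {g : CylinderMetric I N} {G : ℝ → SmoothMetric I N}
    (hg : IsRadialForm g G) {K : SmoothMetric I N} (hK : IsWarpedProduct g (fun _ ↦ 1) K) (r : ℝ)
    (x : N) : fiberMatrix (G r) x = fiberMatrix K x := by
  ext i j
  have h := (hg r x (0, stdBasis d i) (0, stdBasis d j)).symm.trans
    (hK r x (0, stdBasis d i) (0, stdBasis d j))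
  simp only [mul_zero, zero_add, one_pow, one_mul] at h
  exact h

theorem fiberMatrix_eq_of_isAsymptoticAt {g : CylinderMetric I N} {G : ℝ → SmoothMetric I N}
    (hg : IsRadialForm g G) {K Ghat : SmoothMetric I N} (hK : IsWarpedProduct g (fun _ ↦ 1) K)
    {r₀ : EReal} (h : IsAsymptoticAt G (fun _ ↦ 1) Ghat r₀) (x : N) :
    fiberMatrix K x = fiberMatrix Ghat x := by
  have := comap_coe_nhds_neBot r₀
  rw [← sub_eq_zero]
  refine eq_zero_of_tensorNorm_eq_zero (fiberMatrix_posDef Ghat x)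
    (le_antisymm (le_of_forall_pos_le_add fun ε hε ↦ ?_) (Real.sqrt_nonneg _))
  obtain ⟨r, hr⟩ := (h ε hε).exists
  have := hr x
  rw [hg.fiberMatrix_eq_of_product hK] at this
  simpa using this.le

theorem IsWarpedProduct.eq_of_fiberMatrix_eq {g g₀ : CylinderMetric I N} {h : ℝ → ℝ}
    {K L : SmoothMetric I N} (hg : IsWarpedProduct g h K) (hg₀ : IsWarpedProduct g₀ h L)
    (hKL : ∀ x, fiberMatrix K x = fiberMatrix L x) : g = g₀ := by
  have hinner : g.inner = g₀.inner := by
    funext ⟨r, x⟩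
    refine ContinuousLinearMap.ext fun u ↦ ContinuousLinearMap.ext fun v ↦ ?_
    have e : K.inner x u.2 v.2 = L.inner x u.2 v.2 := inner_eq_of_fiberMatrix_eq (hKL x) _ _
    refine (hg r x u v).trans (Eq.trans ?_ (hg₀ r x u v).symm)
    rw [e]
  cases g
  cases g₀
  congr

end Rigidity

end

theorem corollary5p3 {d : ℕ} (hd : 1 ≤ d) {H : Type*} [TopologicalSpace H]
    (I : ModelWithCorners ℝ (EuclideanSpace ℝ (Fin d)) H)
    {N : Type*} [TopologicalSpace N] [ChartedSpace H N] [IsManifold I ∞ N]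
    [CompactSpace N] [T2Space N] [MeasurableSpace N] [BorelSpace N]
    -- the background metric `g₀ = dr² + Ghat`, that is, `h = 1`
    (Ghat : SmoothMetric I N) (g₀ : CylinderMetric I N)
    (hg₀ : IsWarpedProduct g₀ (fun _ ↦ 1) Ghat)
    -- the metric `g = dr² + G(r)`
    (G : ℝ → SmoothMetric I N) (g : CylinderMetric I N) (hg : IsRadialForm g G)
    -- the limits `massBot`, `massTop` of the radial mass at `-∞` and `+∞`
    (massBot massTop : ℝ)
    (hBot : Tendsto (totalRadialMass (fun _ ↦ 1) Ghat g₀ g) atBot (𝓝 massBot))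
    (hTop : Tendsto (totalRadialMass (fun _ ↦ 1) Ghat g₀ g) atTop (𝓝 massTop))
    (hRic : Integrable (radialRicci g) ((volume : Measure ℝ).prod (riemannianVolume Ghat))) :
    (∫ p, radialRicci g p ∂((volume : Measure ℝ).prod (riemannianVolume Ghat))
      ≤ massTop - massBot) ∧
    (massTop - massBot
        = ∫ p, radialRicci g p ∂((volume : Measure ℝ).prod (riemannianVolume Ghat)) ↔
      ∃ K : SmoothMetric I N, IsWarpedProduct g (fun _ ↦ 1) K) ∧
    (∀ r₀ : EReal, IsAsymptoticAt G (fun _ ↦ 1) Ghat r₀ →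
      (massTop - massBot
          = ∫ p, radialRicci g p ∂((volume : Measure ℝ).prod (riemannianVolume Ghat)) ↔
        g = g₀)) := by
  have := isFiniteMeasure_riemannianVolume Ghat
  have := isOpenPosMeasure_riemannianVolume Ghat
  set ν := (volume : Measure ℝ).prod (riemannianVolume Ghat) with hν
  set L := massTop - massBot - ∫ q, radialRicci g q ∂ν with hL
  have hlim := tendsto_setIntegral_trace_weingarten_sq hg₀ hg hBot hTop hRic
  rw [← hν, ← hL] at hlim
  have hmono : Monotone fun n : ℕ ↦ ∫ q in Set.Ioc (-n : ℝ) n ×ˢ Set.univ,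
      (weingarten g q * weingarten g q).trace ∂ν := fun m n hmn ↦
    setIntegral_mono_set ((continuous_trace_weingarten_sq hg).integrableOn_slab _ _)
      (Eventually.of_forall fun q ↦ trace_weingarten_sq_nonneg hg q)
      (monotone_slab hmn).eventuallyLE
  have hnonneg (n : ℕ) : 0 ≤ ∫ q in Set.Ioc (-n : ℝ) n ×ˢ Set.univ,
      (weingarten g q * weingarten g q).trace ∂ν :=
    integral_nonneg fun q ↦ trace_weingarten_sq_nonneg hg q
  have hL0 : 0 ≤ L := ge_of_tendsto' hlim hnonneg
  have hrigid : massTop - massBot = ∫ p, radialRicci g p ∂ν ↔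
      ∃ K : SmoothMetric I N, IsWarpedProduct g (fun _ ↦ 1) K := by
    rw [← sub_eq_zero, ← hL]
    constructor
    · intro h0
      refine ⟨G 0, isWarpedProduct_of_trace_weingarten_sq hg fun q ↦ ?_⟩
      have hae : (fun q ↦ (weingarten g q * weingarten g q).trace) =ᵐ[ν] fun _ ↦ 0 := by
        rw [← Measure.restrict_univ (μ := ν), ← iUnion_slab (N := N), EventuallyEq,
          ae_restrict_iUnion_iff]
        intro n
        have hn := le_antisymm ((hmono.ge_of_tendsto hlim n).trans h0.le) (hnonneg n)
        exact (integral_eq_zero_iff_of_nonneg (fun q ↦ trace_weingarten_sq_nonneg hg q)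
          ((continuous_trace_weingarten_sq hg).integrableOn_slab _ _)).1 hn
      exact congrFun ((Continuous.ae_eq_iff_eq ν (continuous_trace_weingarten_sq hg)
        continuous_const).1 hae) q
    · rintro ⟨K, hK⟩
      refine tendsto_nhds_unique hlim ?_
      simp [hK.weingarten_eq_zero]
  refine ⟨by linarith, hrigid, fun r₀ hr₀ ↦ hrigid.trans ⟨?_, ?_⟩⟩
  · rintro ⟨K, hK⟩
    exact hK.eq_of_fiberMatrix_eq hg₀ (fiberMatrix_eq_of_isAsymptoticAt hg hK hr₀)
  · rintro rfl
    exact ⟨Ghat, hg₀⟩
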